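/- Let $S$ be a nonempty set, $\Sigma$ an algebra of subsets of $S$, $\Delta(S)$ the set of finitely additive probabilities on $\Sigma$, and $X$ a nonempty convex subset of a real vector space. Let $\mathcal F$ be the set of simple acts, i.e. $\Sigma$-measurable maps $f:S\to X$ with finite range, with mixtures taken statewise; elements of $X$ are identified with constant acts. For $K\subseteq\mathbb R$ let $B_0(\Sigma,K)$ be the set of $\Sigma$-measurable simple functions $S\to K$ with the supremum norm. Let $\succsim$ be a binary relation on $\mathcal F$, with asymmetric part $\succ$. $\succsim$ is MBA (monotone, Bernoulli, Archimedean) if (a) it is complete and transitive; (b) (risk independence) for all $x,y,z\in X$ and $\alpha\in(0,1)$, $x\succsim y\iff\alpha x+(1-\alpha)z\succsim\alpha y+(1-\alpha)z$; (c) (Archimedean continuity) if $f\succ g\succ h$ then there are $\alpha,\beta\in(0,1)$ with $\alpha f+(1-\alpha)h\succ g\succ\beta f+(1-\beta)h$; (d) (monotonicity) if $f(s)\succsim g(s)$ for every $s\in S$, then $f\succsim g$. A worst consequence is an $x_*\in X$ with $y\succsim x_*$ for all $y\in X$. Given a worst consequence $x_*$, $\succsim$ exhibits decreasing relative ambiguity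 aversion if for all $f\in\mathcal F$, $y\in X$ and $\alpha\le\beta$ in $(0,1)$, $$\alpha f+(1-\alpha)x_*\succsim\alpha y+(1-\alpha)x_*\ \Longrightarrow\ \beta f+(1-\beta)x_*\succsim\beta y+(1-\beta)x_* .$$ Theorem. The following are equivalent. (i) $\succsim$ is MBA, admits a worst consequence, and exhibits decreasing relative ambiguity aversion. (ii) There exist an affine function $u:X\to\mathbb R$ with $\min u(X)=0$ and a family $\mathcal G$ of functions $G:\mathbb R\times\Delta(S)\to[-\infty,\infty]$ such that - each $G\in\mathcal G$ is monotone (nondecreasing) in the first argument, positively superhomogeneous in the first argument ($G(\gamma t,p)\le\gamma G(t,p)$ for all $\gamma\in(0,1)$, $t\in\mathbb R$, $p\in\Delta(S)$), and quasiconvex on $\mathbb R\times\Delta(S)$; - $\mathcal G$ is linearly continuous: for every $\varphi\in B_0(\Sigma,u(X))$ the maximum $\max_{G\in\mathcal G}\inf_{p\in\Delta(S)}G\left(\int\varphi\,dp,p\right)$ is attained, and it is a continuous function of $\varphi\in B_0(\Sigma,u(X))$; - for all $f,g\in\mathcal F$, $$f\succsim g\iff\max_{G\in\mathcal G}\inf_{p\in\Delta(S)}G\left(\int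 u(f)\,dp,p\right)\ \ge\ \max_{G\in\mathcal G}\inf_{p\in\Delta(S)}G\left(\int u(g)\,dp,p\right);$$ - $\max_{G\in\mathcal G}\inf_{p\in\Delta(S)}G\left(\int u(x)\,dp,p\right)=u(x)$ for all $x\in X$. -/

import Mathlib

open Set Topology

noncomputable section

namespace AmbiguityModel

open MeasureTheory

/-- The unit interval of mixing weights `α ∈ [0,1]`. -/
abbrev Weight : Type := Set.Icc (0 : ℝ) 1

/-- A simple `𝒜`-measurable map `S → Y`: finitely many values, each taken on an event.
Since the range is finite, the preimage of every subset of `Y` is then an event. -/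
structure SimpleMap {S : Type*} {𝒜 : Set (Set S)} (h𝒜 : IsSetAlgebra 𝒜) (Y : Type*) where
  toFun : S → Y
  finite_range : (Set.range toFun).Finite
  measurable_fiber : ∀ y : Y, toFun ⁻¹' {y} ∈ 𝒜

namespace SimpleMap

variable {S : Type*} {𝒜 : Set (Set S)} {h𝒜 : IsSetAlgebra 𝒜} {Y Z W : Type*}

/-- Preimages of arbitrary sets under a map with finite range and measurable fibers. -/
theorem preimage_mem (h : IsSetAlgebra 𝒜) {F : S → Y} (hF : (Set.range F).Finite)
    (hm : ∀ y, F ⁻¹' {y} ∈ 𝒜) (T : Set Y) : F ⁻¹' T ∈ 𝒜 := by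
  classical
  have key : F ⁻¹' T = ⋃ y ∈ hF.toFinset.filter (fun y => y ∈ T), F ⁻¹' {y} := by
    ext s
    simp
  rw [key]
  exact h.biUnion_mem _ (fun y _ => hm y)

/-- The constant simple map. -/
def const (h𝒜 : IsSetAlgebra 𝒜) (y : Y) : SimpleMap h𝒜 Y where
  toFun := fun _ => y
  finite_range := (Set.finite_singleton y).subset (by rintro _ ⟨_, rfl⟩; rfl)
  measurable_fiber := by
    intro z
    by_cases hz : y = z
    · have : (fun _ : S => y) ⁻¹' {z} = Set.univ := by ext s; simp [hz]
      rw [this]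
      exact h𝒜.univ_mem
    · have : (fun _ : S => y) ⁻¹' {z} = ∅ := by ext s; simp [hz]
      rw [this]
      exact h𝒜.empty_mem

/-- Composition `s ↦ c (f s)`. -/
def map (c : Y → Z) (f : SimpleMap h𝒜 Y) : SimpleMap h𝒜 Z where
  toFun := fun s => c (f.toFun s)
  finite_range := (f.finite_range.image c).subset (by
    rintro _ ⟨s, rfl⟩
    exact ⟨f.toFun s, ⟨s, rfl⟩, rfl⟩)
  measurable_fiber := fun z =>
    preimage_mem h𝒜 f.finite_range f.measurable_fiber (c ⁻¹' {z})

/-- The pointwise combination `s ↦ c (f s) (g s)`. -/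
def map₂ (c : Y → Z → W) (f : SimpleMap h𝒜 Y) (g : SimpleMap h𝒜 Z) : SimpleMap h𝒜 W where
  toFun := fun s => c (f.toFun s) (g.toFun s)
  finite_range := (f.finite_range.image2 c g.finite_range).subset (by
    rintro _ ⟨s, rfl⟩
    exact ⟨f.toFun s, ⟨s, rfl⟩, g.toFun s, ⟨s, rfl⟩, rfl⟩)
  measurable_fiber := by
    intro w
    have hr : (Set.range fun s => (f.toFun s, g.toFun s)).Finite :=
      (f.finite_range.prod g.finite_range).subset (by
        rintro _ ⟨s, rfl⟩
        exact ⟨⟨s, rfl⟩, ⟨s, rfl⟩⟩)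
    refine preimage_mem (F := fun s => (f.toFun s, g.toFun s)) h𝒜 hr ?_ {q | c q.1 q.2 = w}
    rintro ⟨y, z⟩
    have : (fun s => (f.toFun s, g.toFun s)) ⁻¹' {(y, z)}
        = f.toFun ⁻¹' {y} ∩ g.toFun ⁻¹' {z} := by
      ext s
      simp
    rw [this]
    exact h𝒜.inter_mem (f.measurable_fiber y) (g.measurable_fiber z)

end SimpleMap

/-- A finitely additive probability measure on the algebra `𝒜`. -/
structure FinAddProb {S : Type*} {𝒜 : Set (Set S)} (h𝒜 : IsSetAlgebra 𝒜) where
  prob : 𝒜 → ℝ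
  nonneg : ∀ A, 0 ≤ prob A
  prob_univ : prob ⟨Set.univ, h𝒜.univ_mem⟩ = 1
  prob_union : ∀ A B : 𝒜, Disjoint A.1 B.1 →
    prob ⟨A.1 ∪ B.1, h𝒜.union_mem A.2 B.2⟩ = prob A + prob B

section Probabilities

variable {S : Type*} {𝒜 : Set (Set S)} {h𝒜 : IsSetAlgebra 𝒜}

/-- The mixture `α p + (1 - α) q` of probabilities. -/
def FinAddProb.mix (α : Weight) (p q : FinAddProb h𝒜) : FinAddProb h𝒜 where
  prob := fun A => (α : ℝ) * p.prob A + (1 - (α : ℝ)) * q.prob A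
  nonneg := fun A => add_nonneg (mul_nonneg α.2.1 (p.nonneg A))
    (mul_nonneg (sub_nonneg.2 α.2.2) (q.nonneg A))
  prob_univ := by rw [p.prob_univ, q.prob_univ]; ring
  prob_union := by
    intro A B hAB
    rw [p.prob_union A B hAB, q.prob_union A B hAB]
    ring

/-- The integral `∫ φ dp` of a real-valued simple function. -/
def integral (φ : SimpleMap h𝒜 ℝ) (p : FinAddProb h𝒜) : ℝ :=
  ∑ t ∈ φ.finite_range.toFinset, t * p.prob ⟨φ.toFun ⁻¹' {t}, φ.measurable_fiber t⟩

/-- `B₀(𝒜, K)`: real-valued simple functions with values in `K`. -/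
def B₀ (h𝒜 : IsSetAlgebra 𝒜) (K : Set ℝ) : Set (SimpleMap h𝒜 ℝ) :=
  {φ | ∀ s, φ.toFun s ∈ K}

/-- Aggregators `G : ℝ × Δ(S) → [-∞, ∞]`, written in curried form. -/
abbrev Aggregator (h𝒜 : IsSetAlgebra 𝒜) : Type _ := ℝ → FinAddProb h𝒜 → EReal

namespace Aggregator

/-- `inf_p G(∫ φ dp, p)`. -/
def infValue (G : Aggregator h𝒜) (φ : SimpleMap h𝒜 ℝ) : EReal :=
  ⨅ p : FinAddProb h𝒜, G (integral φ p) p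

/-- Monotone in the first argument. -/
def MonotoneFst (G : Aggregator h𝒜) : Prop :=
  ∀ p : FinAddProb h𝒜, Monotone fun t : ℝ => G t p

/-- Positively superhomogeneous in the first argument. -/
def PosSuperhomFst (G : Aggregator h𝒜) : Prop :=
  ∀ (p : FinAddProb h𝒜) (t γ : ℝ), 0 < γ → γ < 1 → G (γ * t) p ≤ (γ : EReal) * G t p

/-- Jointly quasiconvex on `ℝ × Δ(S)`. -/
def Quasiconvex (G : Aggregator h𝒜) : Prop :=
  ∀ (α : Weight) (t t' : ℝ) (p p' : FinAddProb h𝒜),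
    G ((α : ℝ) * t + (1 - (α : ℝ)) * t') (FinAddProb.mix α p p') ≤ max (G t p) (G t' p')

end Aggregator

/-- `max_{G ∈ 𝒢} inf_p G(∫ φ dp, p)`. The value is the supremum; that it is attained is the
separate predicate `MaxAttained`. -/
def maxInf (𝒢 : Set (Aggregator h𝒜)) (φ : SimpleMap h𝒜 ℝ) : EReal :=
  ⨆ G ∈ 𝒢, Aggregator.infValue G φ

/-- The maximum over `𝒢` exists at `φ`. -/
def MaxAttained (𝒢 : Set (Aggregator h𝒜)) (φ : SimpleMap h𝒜 ℝ) : Prop :=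
  IsGreatest ((fun G => Aggregator.infValue G φ) '' 𝒢) (maxInf 𝒢 φ)

/-- `𝒢` is linearly continuous on `B₀(𝒜, K)`: the map `φ ↦ max_{G ∈ 𝒢} inf_p G(∫ φ dp, p)` is
well defined (the maximum is attained) and continuous from `B₀(𝒜, K)` with the supremum norm to the
extended reals. -/
def LinearlyContinuous (𝒢 : Set (Aggregator h𝒜)) (K : Set ℝ) : Prop :=
  (∀ φ ∈ B₀ h𝒜 K, MaxAttained 𝒢 φ) ∧
  ∀ φ ∈ B₀ h𝒜 K, ∀ V ∈ 𝓝 (maxInf 𝒢 φ), ∃ δ > (0 : ℝ), ∀ ψ ∈ B₀ h𝒜 K,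
    (∀ s, |ψ.toFun s - φ.toFun s| < δ) → maxInf 𝒢 ψ ∈ V

end Probabilities

section Preferences

variable {S : Type*} {𝒜 : Set (Set S)} {h𝒜 : IsSetAlgebra 𝒜}
variable {E : Type*} [AddCommGroup E] [Module ℝ E] {X : Set E}

/-- Simple acts with consequences in `X`. -/
abbrev Act (h𝒜 : IsSetAlgebra 𝒜) (X : Set E) : Type _ := SimpleMap h𝒜 X

/-- The mixture `α x + (1 - α) y` of consequences. -/
def mixX (hX : Convex ℝ X) (α : Weight) (x y : X) : X :=
  ⟨(α : ℝ) • (x : E) + (1 - (α : ℝ)) • (y : E),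
    hX x.2 y.2 α.2.1 (sub_nonneg.2 α.2.2) (by ring)⟩

/-- The statewise mixture `α f + (1 - α) g` of acts. -/
def mixAct (hX : Convex ℝ X) (α : Weight) (f g : Act h𝒜 X) : Act h𝒜 X :=
  SimpleMap.map₂ (mixX hX α) f g

/-- The constant act `x`. -/
abbrev constAct (h𝒜 : IsSetAlgebra 𝒜) (x : X) : Act h𝒜 X := SimpleMap.const h𝒜 x

/-- Affine utility functions on the convex set `X`. -/
def IsAffine (hX : Convex ℝ X) (u : X → ℝ) : Prop :=
  ∀ (α : Weight) (x y : X), u (mixX hX α x y) = (α : ℝ) * u x + (1 - (α : ℝ)) * u y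

/-- The asymmetric part of a binary relation. -/
def Strict {F : Type*} (R : F → F → Prop) (f g : F) : Prop := R f g ∧ ¬ R g f

/-- Monotone, Bernoulli, Archimedean preferences; `R f g` means that `f` is weakly preferred
to `g`. -/
structure IsMBA (hX : Convex ℝ X) (R : Act h𝒜 X → Act h𝒜 X → Prop) : Prop where
  complete : ∀ f g, R f g ∨ R g f
  transitive : ∀ f g h, R f g → R g h → R f h
  risk_independence : ∀ (x y z : X) (α : Weight), 0 < (α : ℝ) → (α : ℝ) < 1 →
    (R (constAct h𝒜 x) (constAct h𝒜 y) ↔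
      R (constAct h𝒜 (mixX hX α x z)) (constAct h𝒜 (mixX hX α y z)))
  archimedean : ∀ f g h, Strict R f g → Strict R g h →
    ∃ α β : Weight, 0 < (α : ℝ) ∧ (α : ℝ) < 1 ∧ 0 < (β : ℝ) ∧ (β : ℝ) < 1 ∧
      Strict R (mixAct hX α f h) g ∧ Strict R g (mixAct hX β f h)
  monotone : ∀ f g, (∀ s, R (constAct h𝒜 (f.toFun s)) (constAct h𝒜 (g.toFun s))) → R f g

/-- `w` is a worst consequence. -/
def IsWorst (R : Act h𝒜 X → Act h𝒜 X → Prop) (w : X) : Prop :=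
  ∀ y : X, R (constAct h𝒜 y) (constAct h𝒜 w)

/-- Decreasing relative ambiguity aversion, `w` being the worst consequence. -/
def DecreasingRelativeAmbiguityAversion (hX : Convex ℝ X) (R : Act h𝒜 X → Act h𝒜 X → Prop)
    (w : X) : Prop :=
  ∀ (f : Act h𝒜 X) (y : X) (α β : Weight),
    0 < (α : ℝ) → (α : ℝ) ≤ (β : ℝ) → (β : ℝ) < 1 →
    R (mixAct hX α f (constAct h𝒜 w)) (mixAct hX α (constAct h𝒜 y) (constAct h𝒜 w)) →
    R (mixAct hX β f (constAct h𝒜 w)) (mixAct hX β (constAct h𝒜 y) (constAct h𝒜 w))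

end Preferences

end AmbiguityModel

end

/-!
Everything reduces to real functionals on utility profiles.

If a family of aggregators represents the preference, then `φ ↦ max_G inf_p G(∫ φ dp, p)` inherits
monotonicity and superhomogeneity from its members. Monotonicity and linear continuity give the MBA
axioms. A superhomogeneous `V` satisfies `V (α φ) ≤ (α / β) V (β φ)` for `α ≤ β`, which is
decreasing relative ambiguity aversion (`decreasingRelativeAmbiguityAversion_of_maxInf`).

Conversely, the axioms restricted to consequences give an affine utility `u` vanishing at the worst
consequence (`IsMBA.exists_affine_utility`), and the Archimedean axiom gives certainty equivalents.
Thus the preference is represented by a functional `V` on `B₀(𝒜, u(X))`. It is monotone and equals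
`k` at the constant profile `k`. It is also continuous in the supremum norm
(`Represents.exists_lt_of_near`, `Represents.exists_gt_of_near`), since profiles near `φ` lie between
mixtures of `φ` with constants, and superhomogeneous (`Represents.mul_le`) by decreasing relative
ambiguity aversion. It remains to write such a `V` as a maximum of infima. For each profile `φ` put
`G_φ(t, p) = sup {V(φ) λ : λ ≥ 1, λ ∫ φ dp ≤ t}` (`rayAggregator`). This is monotone, superhomogeneous
and quasiconvex because `∫ φ dp` is affine in `p`. Taking `λ = 1` shows that
`inf_p G_φ(∫ φ dp, p) ≥ V(φ)`. For `φ ≠ 0` and any other profile `ψ`, point masses alone show that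
`inf_p G_φ(∫ ψ dp, p)` is `-∞` unless `φ ≤ ψ`, and otherwise is at most `V(φ) λ` for the largest
`λ` with `λ φ ≤ ψ`. Superhomogeneity and monotonicity bound this by `V(λ φ) ≤ V(ψ)`, so no duality
theorem is needed.
-/

namespace AmbiguityModel

open MeasureTheory

/-! ### Integration of simple functions -/

section Integration

variable {S : Type*} {𝒜 : Set (Set S)} {h𝒜 : IsSetAlgebra 𝒜} {Y : Type*}

theorem SimpleMap.ext_fun {f g : SimpleMap h𝒜 Y} (h : ∀ s, f.toFun s = g.toFun s) : f = g := by
  cases f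
  cases g
  obtain rfl := funext h
  rfl

theorem FinAddProb.prob_empty (p : FinAddProb h𝒜) : p.prob ⟨∅, h𝒜.empty_mem⟩ = 0 := by
  have h := p.prob_union ⟨∅, h𝒜.empty_mem⟩ ⟨∅, h𝒜.empty_mem⟩ (by simp)
  simp only [Set.union_empty] at h
  linarith

theorem FinAddProb.prob_preimage_finset (p : FinAddProb h𝒜) (f : SimpleMap h𝒜 Y)
    (F : Finset Y) :
    p.prob ⟨f.toFun ⁻¹' (F : Set Y),
        SimpleMap.preimage_mem h𝒜 f.finite_range f.measurable_fiber _⟩ =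
      ∑ y ∈ F, p.prob ⟨f.toFun ⁻¹' {y}, f.measurable_fiber y⟩ := by
  classical
  induction F using Finset.induction_on with
  | empty => simpa using p.prob_empty
  | insert a F ha ih =>
    rw [Finset.sum_insert ha, ← ih, ← p.prob_union]
    · congr 2
      ext s
      simp
    · rw [Set.disjoint_left]
      rintro s rfl hs
      exact ha (by simpa using hs)

/-- Change of variables: the integral of `c ∘ f` is a sum over the range of `f`, even if `c` is
not injective there. -/
theorem integral_map (p : FinAddProb h𝒜) (f : SimpleMap h𝒜 Y) (c : Y → ℝ) :
    integral (f.map c) p =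
      ∑ y ∈ f.finite_range.toFinset, c y * p.prob ⟨f.toFun ⁻¹' {y}, f.measurable_fiber y⟩ := by
  classical
  have hmaps : ∀ y ∈ f.finite_range.toFinset, c y ∈ (f.map c).finite_range.toFinset := by
    intro y hy
    obtain ⟨s, rfl⟩ := f.finite_range.mem_toFinset.1 hy
    exact (f.map c).finite_range.mem_toFinset.2 ⟨s, rfl⟩
  rw [← Finset.sum_fiberwise_of_maps_to hmaps]
  refine Finset.sum_congr rfl fun t _ => ?_
  have hset : (f.map c).toFun ⁻¹' {t} =
      f.toFun ⁻¹' ((f.finite_range.toFinset.filter (fun y => c y = t) : Finset Y) : Set Y) := by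
    ext s
    simp [SimpleMap.map]
  calc t * p.prob ⟨(f.map c).toFun ⁻¹' {t}, (f.map c).measurable_fiber t⟩
      = t * ∑ y ∈ f.finite_range.toFinset.filter (fun y => c y = t),
          p.prob ⟨f.toFun ⁻¹' {y}, f.measurable_fiber y⟩ := by
        rw [← p.prob_preimage_finset]
        congr 3
    _ = _ := by
        rw [Finset.mul_sum]
        refine Finset.sum_congr rfl fun y hy => ?_
        rw [(Finset.mem_filter.1 hy).2]

theorem integral_mono (p : FinAddProb h𝒜) {φ ψ : SimpleMap h𝒜 ℝ}
    (h : ∀ s, φ.toFun s ≤ ψ.toFun s) : integral φ p ≤ integral ψ p := by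
  -- Both integrals are sums over the range of the pair `(φ, ψ)`.
  have h1 := integral_map p (SimpleMap.map₂ Prod.mk φ ψ) Prod.fst
  have h2 := integral_map p (SimpleMap.map₂ Prod.mk φ ψ) Prod.snd
  change integral φ p = _ at h1
  change integral ψ p = _ at h2
  rw [h1, h2]
  refine Finset.sum_le_sum fun y hy => mul_le_mul_of_nonneg_right ?_ (p.nonneg _)
  obtain ⟨s, rfl⟩ := (SimpleMap.finite_range _).mem_toFinset.1 hy
  exact h s

theorem integral_mul_left (p : FinAddProb h𝒜) (φ : SimpleMap h𝒜 ℝ) (γ : ℝ) :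
    integral (φ.map (γ * ·)) p = γ * integral φ p := by
  rw [integral_map, integral, Finset.mul_sum]
  exact Finset.sum_congr rfl fun y _ => mul_assoc _ _ _

theorem integral_mix (φ : SimpleMap h𝒜 ℝ) (α : Weight) (p q : FinAddProb h𝒜) :
    integral φ (FinAddProb.mix α p q) =
      (α : ℝ) * integral φ p + (1 - (α : ℝ)) * integral φ q := by
  simp only [integral, FinAddProb.mix, Finset.mul_sum, ← Finset.sum_add_distrib]
  exact Finset.sum_congr rfl fun y _ => by ring

open Classical in
/-- The point mass at `s`. -/
noncomputable def FinAddProb.dirac (h𝒜 : IsSetAlgebra 𝒜) (s : S) : FinAddProb h𝒜 where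
  prob := fun A => if s ∈ A.1 then 1 else 0
  nonneg := fun A => by split_ifs <;> norm_num
  prob_univ := by simp
  prob_union := by
    intro A B hAB
    have hs : s ∈ A.1 → s ∉ B.1 := fun h => Set.disjoint_left.1 hAB h
    by_cases hA : s ∈ A.1 <;> by_cases hB : s ∈ B.1 <;> simp_all

theorem integral_dirac (φ : SimpleMap h𝒜 ℝ) (s : S) :
    integral φ (FinAddProb.dirac h𝒜 s) = φ.toFun s := by
  classical
  rw [integral, Finset.sum_eq_single (φ.toFun s)]
  · simp [FinAddProb.dirac]
  · intro t _ ht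
    simp [FinAddProb.dirac, Ne.symm ht]
  · intro h
    exact absurd (φ.finite_range.mem_toFinset.2 ⟨s, rfl⟩) h

end Integration

/-! ### Max-inf functionals and the preferences they represent -/

section MaxInf

variable {S : Type*} {𝒜 : Set (Set S)} {h𝒜 : IsSetAlgebra 𝒜} {Y : Type*}

theorem maxInf_mono {𝒢 : Set (Aggregator h𝒜)} (h𝒢 : ∀ G ∈ 𝒢, G.MonotoneFst)
    {φ ψ : SimpleMap h𝒜 ℝ} (h : ∀ s, φ.toFun s ≤ ψ.toFun s) : maxInf 𝒢 φ ≤ maxInf 𝒢 ψ :=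
  iSup₂_mono fun G hG => iInf_mono fun p => h𝒢 G hG p (integral_mono p h)

theorem maxInf_mul_le {𝒢 : Set (Aggregator h𝒜)} (h𝒢 : ∀ G ∈ 𝒢, G.PosSuperhomFst)
    {φ : SimpleMap h𝒜 ℝ} {γ r : ℝ} (h0 : 0 < γ) (h1 : γ < 1) (hr : maxInf 𝒢 φ ≤ (r : EReal)) :
    maxInf 𝒢 (φ.map (γ * ·)) ≤ ((γ * r : ℝ) : EReal) := by
  have h0' : (0 : EReal) < (γ : EReal) := by exact_mod_cast h0
  refine iSup₂_le fun G hG => ?_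
  have h2 : Aggregator.infValue G (φ.map (γ * ·)) / (γ : EReal) ≤ Aggregator.infValue G φ := by
    refine le_iInf fun p => ?_
    rw [EReal.div_le_iff_le_mul h0' (EReal.coe_ne_top γ)]
    refine (iInf_le _ p).trans ?_
    rw [integral_mul_left]
    exact h𝒢 G hG p _ γ h0 h1
  have h3 := h2.trans ((le_iSup₂ (f := fun G (_ : G ∈ 𝒢) => Aggregator.infValue G φ) G hG).trans hr)
  rw [EReal.div_le_iff_le_mul h0' (EReal.coe_ne_top γ)] at h3
  exact_mod_cast h3

theorem exists_abs_map_sub_le [Nonempty S] (u : Y → ℝ) (f g : SimpleMap h𝒜 Y) :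
    ∃ M > 0, ∀ s, |u (f.toFun s) - u (g.toFun s)| ≤ M := by
  let φ := SimpleMap.map₂ (fun x y => |u x - u y|) f g
  obtain ⟨M, hM⟩ := φ.finite_range.bddAbove
  exact ⟨max M 1, lt_max_of_lt_right one_pos, fun s => (hM ⟨s, rfl⟩).trans (le_max_left _ _)⟩

/-- Near either end of the segment between two maps, a linearly continuous family takes values
close to its value at that end. -/
theorem exists_mix_mem_nhds [Nonempty S] {u : Y → ℝ} {𝒢 : Set (Aggregator h𝒜)}
    (hc : LinearlyContinuous 𝒢 (range u)) (f g : SimpleMap h𝒜 Y)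
    {V : Set EReal} (hV : V ∈ 𝓝 (maxInf 𝒢 (f.map u))) :
    ∃ η : ℝ, 0 < η ∧ η < 1 ∧ ∀ k : SimpleMap h𝒜 Y,
      (∀ s, u (k.toFun s) = (1 - η) * u (f.toFun s) + η * u (g.toFun s)) →
        maxInf 𝒢 (k.map u) ∈ V := by
  obtain ⟨δ, hδ, h⟩ := hc.2 (f.map u) (fun s => ⟨_, rfl⟩) V hV
  obtain ⟨M, hM, hfg⟩ := exists_abs_map_sub_le u g f
  refine ⟨min (1 / 2) (δ / (2 * M)), by positivity, (min_le_left _ _).trans_lt (by norm_num),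
    fun k hk => h _ (fun s => ⟨_, rfl⟩) fun s => ?_⟩
  have hη : min (1 / 2) (δ / (2 * M)) * M ≤ δ / 2 := by
    calc _ ≤ δ / (2 * M) * M := mul_le_mul_of_nonneg_right (min_le_right _ _) hM.le
      _ = δ / 2 := by field_simp
  have hη0 : 0 < min (1 / 2) (δ / (2 * M)) := by positivity
  change |u (k.toFun s) - u (f.toFun s)| < δ
  rw [hk s]
  set η := min (1 / 2) (δ / (2 * M))
  calc |(1 - η) * u (f.toFun s) + η * u (g.toFun s) - u (f.toFun s)|
      = η * |u (g.toFun s) - u (f.toFun s)| := by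
        rw [← abs_of_pos hη0, ← abs_mul, abs_of_pos hη0]
        congr 1
        ring
    _ ≤ η * M := mul_le_mul_of_nonneg_left (hfg s) hη0.le
    _ < δ := by linarith

variable {E : Type*} [AddCommGroup E] [Module ℝ E] {X : Set E}

theorem map_mixAct {hX : Convex ℝ X} {u : X → ℝ} (hu : IsAffine hX u) (α : Weight)
    (f g : Act h𝒜 X) (s : S) : ((mixAct hX α f g).map u).toFun s =
      (α : ℝ) * u (f.toFun s) + (1 - (α : ℝ)) * u (g.toFun s) :=
  hu α _ _

theorem isMBA_of_maxInf [Nonempty S] {hX : Convex ℝ X} {R : Act h𝒜 X → Act h𝒜 X → Prop}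
    {u : X → ℝ} (hu : IsAffine hX u) {𝒢 : Set (Aggregator h𝒜)}
    (hc : LinearlyContinuous 𝒢 (range u)) (hmono : ∀ G ∈ 𝒢, G.MonotoneFst)
    (hrep : ∀ f g, R f g ↔ maxInf 𝒢 (g.map u) ≤ maxInf 𝒢 (f.map u))
    (hnorm : ∀ x : X, maxInf 𝒢 ((constAct h𝒜 x).map u) = ((u x : ℝ) : EReal)) :
    IsMBA hX R := by
  have hconst : ∀ x y, R (constAct h𝒜 x) (constAct h𝒜 y) ↔ u y ≤ u x := fun x y => by
    rw [hrep, hnorm, hnorm, EReal.coe_le_coe_iff]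
  have hstrict : ∀ f g, Strict R f g ↔ maxInf 𝒢 (g.map u) < maxInf 𝒢 (f.map u) := fun f g => by
    rw [Strict, hrep, hrep, lt_iff_le_not_ge]
  refine ⟨fun f g => ?_, fun f g h hfg hgh => ?_, fun x y z α h0 _ => ?_, fun f g h hfg hgh => ?_,
    fun f g hfg => ?_⟩
  · rw [hrep, hrep]
    exact le_total _ _
  · rw [hrep] at *
    exact hgh.trans hfg
  · rw [hconst, hconst, hu, hu, add_le_add_iff_right, mul_le_mul_iff_right₀ h0]
  · rw [hstrict] at hfg hgh
    obtain ⟨η, h0, h1, hη⟩ := exists_mix_mem_nhds hc f h (Ioi_mem_nhds hfg)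
    obtain ⟨θ, h0', h1', hθ⟩ := exists_mix_mem_nhds hc h f (Iio_mem_nhds hgh)
    refine ⟨⟨1 - η, by linarith, by linarith⟩, ⟨θ, h0'.le, h1'.le⟩, by simpa using h1,
      by simpa using h0, h0', h1', (hstrict _ _).2 (hη _ fun s => ?_),
      (hstrict _ _).2 (hθ _ fun s => ?_)⟩
    · exact (map_mixAct hu _ f h s).trans (by ring)
    · exact (map_mixAct hu _ f h s).trans (by ring)
  · rw [hrep]
    exact maxInf_mono hmono fun s => (hconst _ _).1 (hfg s)

/-- Superhomogeneity of the aggregators makes `φ ↦ max_G inf_p G(∫ φ dp, p)` superhomogeneous,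
which is decreasing relative ambiguity aversion. -/
theorem decreasingRelativeAmbiguityAversion_of_maxInf {hX : Convex ℝ X}
    {R : Act h𝒜 X → Act h𝒜 X → Prop} {u : X → ℝ} (hu : IsAffine hX u)
    {𝒢 : Set (Aggregator h𝒜)} (hsuper : ∀ G ∈ 𝒢, G.PosSuperhomFst)
    (hrep : ∀ f g, R f g ↔ maxInf 𝒢 (g.map u) ≤ maxInf 𝒢 (f.map u))
    (hnorm : ∀ x : X, maxInf 𝒢 ((constAct h𝒜 x).map u) = ((u x : ℝ) : EReal))
    {w : X} (hw : u w = 0) : DecreasingRelativeAmbiguityAversion hX R w := by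
  intro f y α β h0 hle h1 hα
  rcases hle.eq_or_lt with heq | hlt
  · rwa [← Subtype.ext heq]
  have hβ0 := h0.trans hlt
  have hcy : ∀ γ : Weight, maxInf 𝒢 ((mixAct hX γ (constAct h𝒜 y) (constAct h𝒜 w)).map u) =
      (((γ : ℝ) * u y : ℝ) : EReal) := fun γ => by
    refine (hnorm (mixX hX γ y w)).trans ?_
    rw [hu, hw, mul_zero, add_zero]
  rw [hrep, hcy] at *
  by_contra! hlt'
  obtain ⟨r, hr1, hr2⟩ := EReal.lt_iff_exists_real_btwn.1 hlt'
  have h := maxInf_mul_le hsuper (div_pos h0 hβ0) ((div_lt_one hβ0).2 hlt) hr1.le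
  have heq : ((mixAct hX β f (constAct h𝒜 w)).map u).map ((α : ℝ) / β * ·) =
      (mixAct hX α f (constAct h𝒜 w)).map u := by
    refine SimpleMap.ext_fun fun s => ?_
    change (α : ℝ) / β * ((mixAct hX β f (constAct h𝒜 w)).map u).toFun s = _
    rw [map_mixAct hu, map_mixAct hu]
    simp only [SimpleMap.const, hw]
    field_simp
    ring
  rw [heq] at h
  have h2 := EReal.coe_le_coe_iff.1 (hα.trans h)
  have hr : r < (β : ℝ) * u y := by exact_mod_cast hr2
  have : (α : ℝ) / β * r < (α : ℝ) / β * (β * u y) :=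
    mul_lt_mul_of_pos_left hr (div_pos h0 hβ0)
  have h3 : (α : ℝ) / β * (β * u y) = α * u y := by field_simp
  linarith

end MaxInf

/-! ### Affine utility and certainty equivalents -/

section Utility

variable {S : Type*} {𝒜 : Set (Set S)} {h𝒜 : IsSetAlgebra 𝒜}
variable {E : Type*} [AddCommGroup E] [Module ℝ E] {X : Set E} {hX : Convex ℝ X}
variable {R : Act h𝒜 X → Act h𝒜 X → Prop}

theorem mixX_of_eq_one {α : Weight} (hα : (α : ℝ) = 1) (x y : X) : mixX hX α x y = x :=
  Subtype.ext (by simp [mixX, hα])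

theorem mixX_of_eq_zero {α : Weight} (hα : (α : ℝ) = 0) (x y : X) : mixX hX α x y = y :=
  Subtype.ext (by simp [mixX, hα])

theorem mixX_mixX_right {α β γ : Weight} (h : (β : ℝ) = γ * α) (x z : X) :
    mixX hX γ (mixX hX α x z) z = mixX hX β x z := by
  refine Subtype.ext ?_
  simp only [mixX, h]
  module

theorem mixX_mixX_left {α β γ : Weight} (h : (β : ℝ) = γ + (1 - γ) * α) (x z : X) :
    mixX hX γ x (mixX hX α x z) = mixX hX β x z := by
  refine Subtype.ext ?_
  simp only [mixX, h]
  module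

theorem exists_mixX_comm (α : Weight) (x y : X) : ∃ β : Weight, (β : ℝ) = 1 - α ∧
    mixX hX α x y = mixX hX β y x := by
  refine ⟨⟨1 - α, sub_nonneg.2 α.2.2, by linarith [α.2.1]⟩, rfl, Subtype.ext ?_⟩
  simp only [mixX]
  module

namespace IsMBA

theorem refl (h : IsMBA hX R) (f : Act h𝒜 X) : R f f := (h.complete f f).elim id id

theorem strict_of_not (h : IsMBA hX R) {f g : Act h𝒜 X} (hfg : ¬ R f g) : Strict R g f :=
  ⟨(h.complete f g).resolve_left hfg, hfg⟩

theorem mix_iff (h : IsMBA hX R) {x y : X} (z : X) {α : Weight} (h0 : 0 < (α : ℝ)) :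
    R (constAct h𝒜 (mixX hX α x z)) (constAct h𝒜 (mixX hX α y z)) ↔
      R (constAct h𝒜 x) (constAct h𝒜 y) := by
  rcases α.2.2.lt_or_eq with h1 | h1
  · exact (h.risk_independence x y z α h0 h1).symm
  · rw [mixX_of_eq_one h1, mixX_of_eq_one h1]

theorem strict_mix_of_lt (h : IsMBA hX R) {x z : X}
    (hxz : Strict R (constAct h𝒜 x) (constAct h𝒜 z)) {α β : Weight} (hβα : (β : ℝ) < α) :
    Strict R (constAct h𝒜 (mixX hX α x z)) (constAct h𝒜 (mixX hX β x z)) := by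
  have hα : 0 < (α : ℝ) := β.2.1.trans_lt hβα
  set a := mixX hX α x z with ha
  have haz : Strict R (constAct h𝒜 a) (constAct h𝒜 z) := by
    have h1 := h.mix_iff (x := x) (y := z) z hα
    have h2 := h.mix_iff (x := z) (y := x) z hα
    have h3 : mixX hX α z z = z := Subtype.ext (by simp only [mixX]; module)
    rw [h3] at h1 h2
    exact ⟨h1.2 hxz.1, fun hh => hxz.2 (h2.1 hh)⟩
  -- `β` is a proper fraction `1 - γ` of `α`, so `mixX β x z` mixes `z` into `a` with weight `γ`.
  have hγ1 : (β : ℝ) / α < 1 := (div_lt_one hα).2 hβα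
  let γ : Weight := ⟨1 - (β : ℝ) / α, by linarith, by linarith [div_nonneg β.2.1 hα.le]⟩
  have hγ : 0 < (γ : ℝ) := by simpa [γ] using hγ1
  have e1 : mixX hX γ a a = a := Subtype.ext (by simp only [mixX]; module)
  have e2 : mixX hX γ z a = mixX hX β x z := by
    have hβ : (β : ℝ) = (1 - (γ : ℝ)) * α := by
      simp only [γ]
      field_simp
      ring
    refine Subtype.ext ?_
    simp only [ha, mixX, hβ]
    module
  have h1 := h.mix_iff (x := a) (y := z) a hγ
  have h2 := h.mix_iff (x := z) (y := a) a hγ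
  rw [e1, e2] at h1 h2
  exact ⟨h1.2 haz.1, fun hh => haz.2 (h2.1 hh)⟩

theorem mix_iff_le (h : IsMBA hX R) {x z : X}
    (hxz : Strict R (constAct h𝒜 x) (constAct h𝒜 z)) {α β : Weight} :
    R (constAct h𝒜 (mixX hX α x z)) (constAct h𝒜 (mixX hX β x z)) ↔ (β : ℝ) ≤ α := by
  constructor
  · intro hh
    by_contra! hlt
    exact (h.strict_mix_of_lt hxz hlt).2 hh
  · intro hle
    rcases hle.lt_or_eq with hlt | heq
    · exact (h.strict_mix_of_lt hxz hlt).1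
    · rw [Subtype.ext heq]
      exact h.refl _

/-- Solvability: an act between two consequences is indifferent to one of their mixtures. The weight
is the infimum of those whose mixture is at least as good as the act. -/
theorem exists_mix_indifferent (h : IsMBA hX R) {x z : X} {f : Act h𝒜 X}
    (hxf : R (constAct h𝒜 x) f) (hfz : R f (constAct h𝒜 z)) :
    ∃ α : Weight, R (constAct h𝒜 (mixX hX α x z)) f ∧ R f (constAct h𝒜 (mixX hX α x z)) := by
  by_cases hfx : R f (constAct h𝒜 x)
  · refine ⟨⟨1, by norm_num, le_rfl⟩, ?_⟩
    rw [mixX_of_eq_one rfl]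
    exact ⟨hxf, hfx⟩
  by_cases hzf : R (constAct h𝒜 z) f
  · refine ⟨⟨0, le_rfl, by norm_num⟩, ?_⟩
    rw [mixX_of_eq_zero rfl]
    exact ⟨hzf, hfz⟩
  have hxz : Strict R (constAct h𝒜 x) (constAct h𝒜 z) :=
    ⟨h.transitive _ _ _ hxf hfz, fun hh => hzf (h.transitive _ _ _ hh hxf)⟩
  let A : Set ℝ := {a | ∃ α : Weight, (α : ℝ) = a ∧ R (constAct h𝒜 (mixX hX α x z)) f}
  have hA0 : ∀ a ∈ A, 0 ≤ a := by
    rintro _ ⟨α, rfl, -⟩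
    exact α.2.1
  have hA1 : (1 : ℝ) ∈ A :=
    ⟨⟨1, by norm_num, le_rfl⟩, rfl, by rwa [mixX_of_eq_one rfl]⟩
  have hbdd : BddBelow A := ⟨0, hA0⟩
  let α : Weight := ⟨sInf A, Real.sInf_nonneg hA0, csInf_le hbdd hA1⟩
  refine ⟨α, ?_, ?_⟩
  · by_contra hn
    obtain ⟨-, β, -, -, hβ0, hβ1, -, hβ⟩ :=
      h.archimedean _ _ _ (⟨hxf, hfx⟩ : Strict R (constAct h𝒜 x) f) (h.strict_of_not hn)
    let γ : Weight := ⟨(β : ℝ) + (1 - β) * α,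
      add_nonneg hβ0.le (mul_nonneg (sub_nonneg.2 hβ1.le) α.2.1), by
        nlinarith [mul_nonneg (sub_nonneg.2 hβ1.le) (sub_nonneg.2 α.2.2)]⟩
    change Strict R f (constAct h𝒜 (mixX hX β x (mixX hX α x z))) at hβ
    rw [mixX_mixX_left (β := γ) rfl] at hβ
    have hle : (γ : ℝ) ≤ sInf A := by
      refine le_csInf ⟨1, hA1⟩ ?_
      rintro _ ⟨δ, rfl, hδ⟩
      exact (h.mix_iff_le hxz).1 (h.transitive _ _ _ hδ hβ.1)
    have hα1 : (α : ℝ) < 1 := by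
      refine α.2.2.lt_of_ne fun h1 => hn ?_
      rwa [mixX_of_eq_one h1]
    have : (γ : ℝ) ≤ α := hle
    simp only [γ] at this
    nlinarith [mul_pos hβ0 (sub_pos.2 hα1)]
  · by_contra hn
    obtain ⟨β, -, hβ0, hβ1, -, -, hβ, -⟩ :=
      h.archimedean _ _ _ (h.strict_of_not hn) (⟨hfz, hzf⟩ : Strict R f (constAct h𝒜 z))
    let γ : Weight := ⟨(β : ℝ) * α, mul_nonneg hβ0.le α.2.1,
      mul_le_one₀ hβ1.le α.2.1 α.2.2⟩
    change Strict R (constAct h𝒜 (mixX hX β (mixX hX α x z) z)) f at hβ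
    rw [mixX_mixX_right (β := γ) rfl] at hβ
    have hle : sInf A ≤ (γ : ℝ) := csInf_le hbdd ⟨γ, rfl, hβ.1⟩
    have hα0 : 0 < (α : ℝ) := by
      refine α.2.1.lt_of_ne fun h0 => hn ?_
      rwa [mixX_of_eq_zero h0.symm]
    have : (α : ℝ) ≤ β * α := hle
    nlinarith [mul_pos hα0 (sub_pos.2 hβ1)]

end IsMBA

/-- The consequence `x` has utility `r` on the scale where `w` is worth `0` and `b` is worth `1`:
after scaling by some weight `t` towards `w`, `x` is indifferent to `b` scaled by `t * r`. Scaling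
down makes room for consequences better than `b`. -/
def UtilityOnScale (hX : Convex ℝ X) (R : Act h𝒜 X → Act h𝒜 X → Prop) (w b x : X) (r : ℝ) :
    Prop :=
  ∃ t a : Weight, 0 < (t : ℝ) ∧ (a : ℝ) = t * r ∧
    R (constAct h𝒜 (mixX hX t x w)) (constAct h𝒜 (mixX hX a b w)) ∧
    R (constAct h𝒜 (mixX hX a b w)) (constAct h𝒜 (mixX hX t x w))

theorem IsMBA.exists_utilityOnScale (h : IsMBA hX R) {w b : X} (hw : IsWorst R w)
    (hb : Strict R (constAct h𝒜 b) (constAct h𝒜 w)) (x : X) :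
    ∃ r, UtilityOnScale hX R w b x r := by
  rcases h.complete (constAct h𝒜 b) (constAct h𝒜 x) with hbx | hxb
  · obtain ⟨α, h1, h2⟩ := h.exists_mix_indifferent hbx (hw x)
    refine ⟨α, ⟨1, by norm_num, le_rfl⟩, α, one_pos, (one_mul _).symm, ?_⟩
    rw [mixX_of_eq_one rfl]
    exact ⟨h2, h1⟩
  · obtain ⟨α, h1, h2⟩ := h.exists_mix_indifferent hxb (hw b)
    have hα : 0 < (α : ℝ) := by
      refine α.2.1.lt_of_ne fun h0 => hb.2 ?_
      rwa [mixX_of_eq_zero h0.symm] at h1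
    refine ⟨(α : ℝ)⁻¹, α, ⟨1, by norm_num, le_rfl⟩, hα, (mul_inv_cancel₀ hα.ne').symm, ?_⟩
    rw [mixX_of_eq_one rfl (hX := hX) b]
    exact ⟨h1, h2⟩

theorem UtilityOnScale.nonneg {w b x : X} {r : ℝ} (hx : UtilityOnScale hX R w b x r) : 0 ≤ r := by
  obtain ⟨t, a, ht, ha, -⟩ := hx
  exact nonneg_of_mul_nonneg_right (ha ▸ a.2.1) ht

/-- The scaling weight in `UtilityOnScale` may be decreased. -/
theorem UtilityOnScale.scale (h : IsMBA hX R) {w b x : X} {r : ℝ}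
    (hx : UtilityOnScale hX R w b x r) : ∃ t₀ > 0, ∀ t : Weight, 0 < (t : ℝ) → (t : ℝ) ≤ t₀ →
      ∃ a : Weight, (a : ℝ) = t * r ∧
        R (constAct h𝒜 (mixX hX t x w)) (constAct h𝒜 (mixX hX a b w)) ∧
        R (constAct h𝒜 (mixX hX a b w)) (constAct h𝒜 (mixX hX t x w)) := by
  obtain ⟨t₀, a, ht₀, ha, h1, h2⟩ := hx
  refine ⟨t₀, ht₀, fun t ht hle => ?_⟩
  let γ : Weight := ⟨(t : ℝ) / t₀, by positivity, (div_le_one ht₀).2 hle⟩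
  have hγ : 0 < (γ : ℝ) := div_pos ht ht₀
  let a' : Weight := ⟨γ * a, mul_nonneg hγ.le a.2.1, mul_le_one₀ γ.2.2 a.2.1 a.2.2⟩
  have e1 : mixX hX γ (mixX hX t₀ x w) w = mixX hX t x w :=
    mixX_mixX_right (by simp only [γ]; field_simp) x w
  have e2 : mixX hX γ (mixX hX a b w) w = mixX hX a' b w := mixX_mixX_right rfl b w
  refine ⟨a', ?_, ?_, ?_⟩
  · simp only [a', γ, ha]
    field_simp
  · rw [← e1, ← e2]
    exact (h.mix_iff w hγ).2 h1
  · rw [← e1, ← e2]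
    exact (h.mix_iff w hγ).2 h2

theorem UtilityOnScale.common_scale (h : IsMBA hX R) {w b x y : X} {r q : ℝ}
    (hx : UtilityOnScale hX R w b x r) (hy : UtilityOnScale hX R w b y q) :
    ∃ t a c : Weight, 0 < (t : ℝ) ∧ (a : ℝ) = t * r ∧ (c : ℝ) = t * q ∧
      (R (constAct h𝒜 (mixX hX t x w)) (constAct h𝒜 (mixX hX a b w)) ∧
        R (constAct h𝒜 (mixX hX a b w)) (constAct h𝒜 (mixX hX t x w))) ∧
      (R (constAct h𝒜 (mixX hX t y w)) (constAct h𝒜 (mixX hX c b w)) ∧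
        R (constAct h𝒜 (mixX hX c b w)) (constAct h𝒜 (mixX hX t y w))) := by
  obtain ⟨t₁, ht₁, h₁⟩ := hx.scale h
  obtain ⟨t₂, ht₂, h₂⟩ := hy.scale h
  let t : Weight := ⟨min 1 (min t₁ t₂), by positivity, min_le_left _ _⟩
  have ht : 0 < (t : ℝ) := by simp only [t]; positivity
  obtain ⟨a, ha, ha'⟩ := h₁ t ht ((min_le_right _ _).trans (min_le_left _ _))
  obtain ⟨c, hc, hc'⟩ := h₂ t ht ((min_le_right _ _).trans (min_le_right _ _))
  exact ⟨t, a, c, ht, ha, hc, ha', hc'⟩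

theorem UtilityOnScale.rel_iff (h : IsMBA hX R) {w b x y : X}
    (hb : Strict R (constAct h𝒜 b) (constAct h𝒜 w)) {r q : ℝ}
    (hx : UtilityOnScale hX R w b x r) (hy : UtilityOnScale hX R w b y q) :
    R (constAct h𝒜 x) (constAct h𝒜 y) ↔ q ≤ r := by
  obtain ⟨t, a, c, ht, ha, hc, ⟨h1, h2⟩, h3, h4⟩ := hx.common_scale h hy
  rw [← h.mix_iff w ht, ← mul_le_mul_iff_right₀ ht, ← ha, ← hc, ← h.mix_iff_le hb]
  exact ⟨fun hh => h.transitive _ _ _ h2 (h.transitive _ _ _ hh h3),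
    fun hh => h.transitive _ _ _ h1 (h.transitive _ _ _ hh h4)⟩

theorem IsMBA.mix_congr (h : IsMBA hX R) {x x' y y' : X} (α : Weight)
    (hx : R (constAct h𝒜 x) (constAct h𝒜 x')) (hy : R (constAct h𝒜 y) (constAct h𝒜 y')) :
    R (constAct h𝒜 (mixX hX α x y)) (constAct h𝒜 (mixX hX α x' y')) := by
  rcases α.2.1.eq_or_lt with h0 | h0
  · rwa [mixX_of_eq_zero h0.symm, mixX_of_eq_zero h0.symm]
  rcases α.2.2.eq_or_lt with h1 | h1
  · rwa [mixX_of_eq_one h1, mixX_of_eq_one h1]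
  refine h.transitive _ _ _ ((h.mix_iff y h0).2 hx) ?_
  obtain ⟨β, hβ, e⟩ := exists_mixX_comm (hX := hX) α x' y
  obtain ⟨β', hβ', e'⟩ := exists_mixX_comm (hX := hX) α x' y'
  obtain rfl : β = β' := Subtype.ext (hβ.trans hβ'.symm)
  rw [e, e']
  exact (h.mix_iff x' (by rw [hβ]; linarith)).2 hy

theorem UtilityOnScale.mix (h : IsMBA hX R) {w b x y : X} {r q : ℝ} (α : Weight)
    (hx : UtilityOnScale hX R w b x r) (hy : UtilityOnScale hX R w b y q) :
    UtilityOnScale hX R w b (mixX hX α x y) ((α : ℝ) * r + (1 - (α : ℝ)) * q) := by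
  obtain ⟨t, a, c, ht, ha, hc, ⟨h1, h2⟩, h3, h4⟩ := hx.common_scale h hy
  have hα := sub_nonneg.2 α.2.2
  let d : Weight := ⟨(α : ℝ) * a + (1 - (α : ℝ)) * c,
    add_nonneg (mul_nonneg α.2.1 a.2.1) (mul_nonneg hα c.2.1), by
      nlinarith [mul_le_mul_of_nonneg_left a.2.2 α.2.1, mul_le_mul_of_nonneg_left c.2.2 hα]⟩
  have e1 : mixX hX t (mixX hX α x y) w = mixX hX α (mixX hX t x w) (mixX hX t y w) := by
    refine Subtype.ext ?_
    simp only [mixX]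
    module
  have e2 : mixX hX d b w = mixX hX α (mixX hX a b w) (mixX hX c b w) := by
    refine Subtype.ext ?_
    simp only [mixX, d]
    module
  refine ⟨t, d, ht, ?_, ?_, ?_⟩
  · simp only [d, ha, hc]
    ring
  · rw [e1, e2]
    exact h.mix_congr α h1 h3
  · rw [e1, e2]
    exact h.mix_congr α h2 h4

/-- The mixture-space theorem, normalized at a worst consequence. -/
theorem IsMBA.exists_affine_utility (h : IsMBA hX R) {w : X} (hw : IsWorst R w) :
    ∃ u : X → ℝ, IsAffine hX u ∧ u w = 0 ∧ (∀ x, 0 ≤ u x) ∧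
      ∀ x y, R (constAct h𝒜 x) (constAct h𝒜 y) ↔ u y ≤ u x := by
  by_cases hb : ∃ b, ¬ R (constAct h𝒜 w) (constAct h𝒜 b)
  · obtain ⟨b, hb⟩ := hb
    have hbw := h.strict_of_not hb
    choose u hu using h.exists_utilityOnScale hw hbw
    have huniq : ∀ {x : X} {r : ℝ}, UtilityOnScale hX R w b x r → u x = r := fun hr =>
      le_antisymm ((UtilityOnScale.rel_iff h hbw hr (hu _)).1 (h.refl _))
        ((UtilityOnScale.rel_iff h hbw (hu _) hr).1 (h.refl _))
    refine ⟨u, fun α x y => huniq (UtilityOnScale.mix h α (hu x) (hu y)), huniq ?_,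
      fun x => (hu x).nonneg, fun x y => UtilityOnScale.rel_iff h hbw (hu x) (hu y)⟩
    refine ⟨⟨1, by norm_num, le_rfl⟩, ⟨0, le_rfl, by norm_num⟩, one_pos, by simp, ?_⟩
    rw [mixX_of_eq_one rfl, mixX_of_eq_zero rfl]
    exact ⟨h.refl _, h.refl _⟩
  · push Not at hb
    refine ⟨fun _ => 0, fun α x y => by simp, rfl, fun _ => le_rfl, fun x y => ?_⟩
    simpa using h.transitive _ _ _ (hw x) (hb y)

theorem IsMBA.exists_certainty_equivalent [Nonempty S] (h : IsMBA hX R) {u : X → ℝ}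
    (hu : ∀ x y, R (constAct h𝒜 x) (constAct h𝒜 y) ↔ u y ≤ u x) (f : Act h𝒜 X) :
    ∃ x, R (constAct h𝒜 x) f ∧ R f (constAct h𝒜 x) := by
  obtain ⟨x, -, hx⟩ := Set.exists_max_image _ u f.finite_range (range_nonempty _)
  obtain ⟨z, -, hz⟩ := Set.exists_min_image _ u f.finite_range (range_nonempty _)
  obtain ⟨α, hα⟩ := h.exists_mix_indifferent
    (h.monotone (constAct h𝒜 x) f fun s => (hu _ _).2 (hx _ ⟨s, rfl⟩))
    (h.monotone f (constAct h𝒜 z) fun s => (hu _ _).2 (hz _ ⟨s, rfl⟩))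
  exact ⟨_, hα⟩

end Utility

/-! ### The utility functional of a preference -/

section Functional

variable {S : Type*} {𝒜 : Set (Set S)} {h𝒜 : IsSetAlgebra 𝒜}

theorem SimpleMap.exists_map_eq {Y Z : Type*} [Nonempty Y] {c : Y → Z} {φ : SimpleMap h𝒜 Z}
    (hφ : ∀ s, φ.toFun s ∈ range c) : ∃ f : SimpleMap h𝒜 Y, f.map c = φ :=
  ⟨φ.map (Function.invFun c), SimpleMap.ext_fun fun s => Function.invFun_eq (hφ s)⟩

theorem SimpleMap.exists_pos_le (φ : SimpleMap h𝒜 ℝ) :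
    ∃ δ > 0, ∀ s, 0 < φ.toFun s → δ ≤ φ.toFun s := by
  have hfin : (range φ.toFun ∩ Ioi 0).Finite := φ.finite_range.inter_of_left _
  rcases (range φ.toFun ∩ Ioi 0).eq_empty_or_nonempty with he | hne
  · exact ⟨1, one_pos, fun s hs =>
      absurd (show φ.toFun s ∈ range φ.toFun ∩ Ioi 0 from ⟨⟨s, rfl⟩, hs⟩) (he ▸ notMem_empty _)⟩
  · obtain ⟨δ, hδ, hmin⟩ := Set.exists_min_image _ id hfin hne
    exact ⟨δ, hδ.2, fun s hs => hmin _ ⟨⟨s, rfl⟩, hs⟩⟩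

variable {E : Type*} {X : Set E}

/-- `V` turns utility profiles of acts into the utilities of their certainty equivalents, and
represents `R`. -/
structure Represents (R : Act h𝒜 X → Act h𝒜 X → Prop) (u : X → ℝ) (V : SimpleMap h𝒜 ℝ → ℝ) :
    Prop where
  rel_iff : ∀ f g, R f g ↔ V (g.map u) ≤ V (f.map u)
  const : ∀ x, V ((constAct h𝒜 x).map u) = u x
  mem_range : ∀ φ, V φ ∈ range u

variable {R : Act h𝒜 X → Act h𝒜 X → Prop} {u : X → ℝ} {V : SimpleMap h𝒜 ℝ → ℝ}

theorem Represents.strict_iff (hV : Represents R u V) (f g : Act h𝒜 X) :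
    Strict R f g ↔ V (g.map u) < V (f.map u) := by
  rw [Strict, hV.rel_iff, hV.rel_iff, lt_iff_le_not_ge]

variable [AddCommGroup E] [Module ℝ E] {hX : Convex ℝ X}

theorem IsAffine.ordConnected_range (hu : IsAffine hX u) : (range u).OrdConnected := by
  refine ⟨?_⟩
  rintro _ ⟨x, rfl⟩ _ ⟨y, rfl⟩ r ⟨h1, h2⟩
  rcases (h1.trans h2).eq_or_lt with heq | hlt
  · exact ⟨x, le_antisymm h1 (heq ▸ h2)⟩
  have hpos := sub_pos.2 hlt
  let α : Weight := ⟨(r - u x) / (u y - u x), div_nonneg (sub_nonneg.2 h1) hpos.le,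
    (div_le_one hpos).2 (by linarith)⟩
  refine ⟨mixX hX α y x, ?_⟩
  rw [hu]
  simp only [α]
  field_simp
  ring

theorem IsMBA.exists_represents [Nonempty S] (hX' : X.Nonempty) (h : IsMBA hX R)
    (hu : ∀ x y, R (constAct h𝒜 x) (constAct h𝒜 y) ↔ u y ≤ u x) : ∃ V, Represents R u V := by
  have : Nonempty X := hX'.to_subtype
  choose ce hce1 hce2 using h.exists_certainty_equivalent hu
  -- Acts with the same utility profile are indifferent, so any lift of the profile will do.
  have hlift : ∀ f : Act h𝒜 X, R ((f.map u).map (Function.invFun u)) f ∧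
      R f ((f.map u).map (Function.invFun u)) := fun f => by
    have he : ∀ s, u (((f.map u).map (Function.invFun u)).toFun s) = u (f.toFun s) := fun s =>
      Function.invFun_eq ⟨f.toFun s, rfl⟩
    exact ⟨h.monotone _ _ fun s => (hu _ _).2 (he s).ge,
      h.monotone _ _ fun s => (hu _ _).2 (he s).le⟩
  have hV1 : ∀ f : Act h𝒜 X, R (constAct h𝒜 (ce ((f.map u).map (Function.invFun u)))) f :=
    fun f => h.transitive _ _ _ (hce1 _) (hlift f).1
  have hV2 : ∀ f : Act h𝒜 X, R f (constAct h𝒜 (ce ((f.map u).map (Function.invFun u)))) :=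
    fun f => h.transitive _ _ _ (hlift f).2 (hce2 _)
  refine ⟨fun φ => u (ce (φ.map (Function.invFun u))), fun f g => ?_, fun x => ?_,
    fun φ => ⟨_, rfl⟩⟩
  · rw [← hu]
    exact ⟨fun hfg => h.transitive _ _ _ (hV1 f) (h.transitive _ _ _ hfg (hV2 g)),
      fun hfg => h.transitive _ _ _ (hV2 f) (h.transitive _ _ _ hfg (hV1 g))⟩
  · exact le_antisymm ((hu _ _).1 (hV2 (constAct h𝒜 x))) ((hu _ _).1 (hV1 (constAct h𝒜 x)))

namespace Represents

theorem mono (hV : Represents R u V) (hX' : X.Nonempty) (h : IsMBA hX R) {φ ψ : SimpleMap h𝒜 ℝ}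
    (hφ : φ ∈ B₀ h𝒜 (range u)) (hψ : ψ ∈ B₀ h𝒜 (range u)) (hle : ∀ s, φ.toFun s ≤ ψ.toFun s) :
    V φ ≤ V ψ := by
  have : Nonempty X := hX'.to_subtype
  obtain ⟨f, rfl⟩ := SimpleMap.exists_map_eq hφ
  obtain ⟨g, rfl⟩ := SimpleMap.exists_map_eq hψ
  refine (hV.rel_iff _ _).1 (h.monotone _ _ fun s => ?_)
  rw [hV.rel_iff, hV.const, hV.const]
  exact hle s

/-- Lower semicontinuity. As `0` is the least utility, profiles near `φ` dominate `α φ` for some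
`α < 1`, and the Archimedean axiom controls `V (α φ)`. -/
theorem exists_lt_of_near (hV : Represents R u V) (hX' : X.Nonempty) (h : IsMBA hX R)
    (hu : IsAffine hX u) (h0 : IsLeast (range u) 0) {φ : SimpleMap h𝒜 ℝ}
    (hφ : φ ∈ B₀ h𝒜 (range u)) {v : ℝ} (hv : v < V φ) :
    ∃ δ > 0, ∀ ψ ∈ B₀ h𝒜 (range u), (∀ s, |ψ.toFun s - φ.toFun s| < δ) → v < V ψ := by
  have : Nonempty X := hX'.to_subtype
  rcases lt_or_ge v 0 with hv0 | hv0
  · exact ⟨1, one_pos, fun ψ _ _ => hv0.trans_le (h0.2 (hV.mem_range ψ))⟩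
  obtain ⟨c, hvc, hc⟩ := exists_between hv
  obtain ⟨y, rfl⟩ : c ∈ range u :=
    hu.ordConnected_range.out h0.1 (hV.mem_range φ) ⟨hv0.trans hvc.le, hc.le⟩
  obtain ⟨w, hw⟩ := h0.1
  obtain ⟨f, rfl⟩ := SimpleMap.exists_map_eq hφ
  obtain ⟨α, -, hα0, hα1, -, -, hα, -⟩ := h.archimedean f (constAct h𝒜 y) (constAct h𝒜 w)
    ((hV.strict_iff _ _).2 (by rwa [hV.const]))
    ((hV.strict_iff _ _).2 (by rw [hV.const, hV.const, hw]; exact hv0.trans_lt hvc))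
  rw [hV.strict_iff, hV.const] at hα
  obtain ⟨δ, hδ, hmin⟩ := (f.map u).exists_pos_le
  refine ⟨(1 - α) * δ, mul_pos (sub_pos.2 hα1) hδ, fun ψ hψ hnear => hvc.trans (hα.trans_le ?_)⟩
  refine hV.mono hX' h (fun s => ⟨_, rfl⟩) hψ fun s => ?_
  rw [map_mixAct hu]
  simp only [SimpleMap.const, hw, mul_zero, add_zero]
  have hs : 0 ≤ u (f.toFun s) := h0.2 ⟨_, rfl⟩
  rcases hs.eq_or_lt with heq | hlt
  · rw [← heq, mul_zero]
    exact h0.2 (hψ s)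
  · have h1 : δ ≤ u (f.toFun s) := hmin s hlt
    have h2 : -((1 - α) * δ) < ψ.toFun s - u (f.toFun s) := (abs_lt.1 (hnear s)).1
    nlinarith [mul_le_mul_of_nonneg_left h1 (sub_pos.2 hα1).le]

/-- Upper semicontinuity. Profiles near `φ` are dominated by a mixture of `φ` with a constant that
exceeds `φ` wherever there is room above. -/
theorem exists_gt_of_near [Nonempty S] (hV : Represents R u V) (hX' : X.Nonempty)
    (h : IsMBA hX R) (hu : IsAffine hX u) {φ : SimpleMap h𝒜 ℝ}
    (hφ : φ ∈ B₀ h𝒜 (range u)) {v : ℝ} (hv : V φ < v) :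
    ∃ δ > 0, ∀ ψ ∈ B₀ h𝒜 (range u), (∀ s, |ψ.toFun s - φ.toFun s| < δ) → V ψ < v := by
  have : Nonempty X := hX'.to_subtype
  by_cases hmax : ∀ r ∈ range u, r ≤ V φ
  · exact ⟨1, one_pos, fun ψ _ _ => (hmax _ (hV.mem_range ψ)).trans_lt hv⟩
  push Not at hmax
  obtain ⟨m, hm, hm'⟩ := hmax
  obtain ⟨b, hbV, hb⟩ : ∃ b, V φ < u b ∧
      ∀ s, φ.toFun s < u b ∨ (φ.toFun s ≤ u b ∧ ∀ r ∈ range u, r ≤ u b) := by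
    by_cases hub : ∃ b, ∀ r ∈ range u, r ≤ u b
    · obtain ⟨b, hb⟩ := hub
      exact ⟨b, hm'.trans_le (hb _ hm), fun s => Or.inr ⟨hb _ (hφ s), hb⟩⟩
    · push Not at hub
      obtain ⟨_, ⟨s₀, rfl⟩, hs₀⟩ :=
        Set.exists_max_image _ id φ.finite_range (range_nonempty _)
      obtain ⟨z, hz⟩ : max m (φ.toFun s₀) ∈ range u := by
        rcases max_choice m (φ.toFun s₀) with he | he <;> rw [he]
        exacts [hm, hφ s₀]
      obtain ⟨_, ⟨b, rfl⟩, hb⟩ := hub z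
      rw [hz, max_lt_iff] at hb
      exact ⟨b, hm'.trans hb.1, fun s => Or.inl ((hs₀ _ ⟨s, rfl⟩).trans_lt hb.2)⟩
  obtain ⟨c, hc, hc'⟩ := exists_between (lt_min hv hbV)
  obtain ⟨y, rfl⟩ : c ∈ range u := hu.ordConnected_range.out (hV.mem_range φ) ⟨b, rfl⟩
    ⟨hc.le, (hc'.trans_le (min_le_right _ _)).le⟩
  have hyv := hc'.trans_le (min_le_left _ _)
  have hyb := hc'.trans_le (min_le_right _ _)
  obtain ⟨f, rfl⟩ := SimpleMap.exists_map_eq hφ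
  obtain ⟨-, β, -, -, hβ0, hβ1, -, hβ⟩ := h.archimedean (constAct h𝒜 b) (constAct h𝒜 y) f
    ((hV.strict_iff _ _).2 (by rwa [hV.const, hV.const]))
    ((hV.strict_iff _ _).2 (by rwa [hV.const]))
  rw [hV.strict_iff, hV.const] at hβ
  obtain ⟨δ, hδ, hmin⟩ := ((f.map u).map (u b - ·)).exists_pos_le
  refine ⟨β * δ, mul_pos hβ0 hδ, fun ψ hψ hnear => lt_of_le_of_lt ?_ (hβ.trans hyv)⟩
  refine hV.mono hX' h hψ (fun s => ⟨_, rfl⟩) fun s => ?_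
  rw [map_mixAct hu]
  simp only [SimpleMap.const]
  have h2 : ψ.toFun s - u (f.toFun s) < β * δ := (abs_lt.1 (hnear s)).2
  have key : u (f.toFun s) < u b →
      ψ.toFun s ≤ (β : ℝ) * u b + (1 - (β : ℝ)) * u (f.toFun s) := fun hlt => by
    have h1 : δ ≤ u b - u (f.toFun s) := hmin s (sub_pos.2 hlt)
    nlinarith [mul_le_mul_of_nonneg_left h1 hβ0.le]
  rcases hb s with hlt | ⟨hle, hub⟩
  · exact key hlt
  · rcases hle.lt_or_eq with hlt | heq
    · exact key hlt
    · have heq' : u (f.toFun s) = u b := heq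
      rw [heq']
      linarith [hub _ (hψ s)]

/-- Decreasing relative ambiguity aversion makes the functional superhomogeneous. -/
theorem mul_le [Nonempty S] (hV : Represents R u V) (hX' : X.Nonempty) (h : IsMBA hX R)
    (hu : IsAffine hX u) (h0 : IsLeast (range u) 0) {w : X} (hw : u w = 0)
    (hd : DecreasingRelativeAmbiguityAversion hX R w) {φ : SimpleMap h𝒜 ℝ}
    (hφ : φ ∈ B₀ h𝒜 (range u)) {γ : ℝ} (hγ0 : 0 < γ) (hγ1 : γ ≤ 1) :
    V (φ.map (γ * ·)) ≤ γ * V φ := by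
  have : Nonempty X := hX'.to_subtype
  obtain ⟨f, rfl⟩ := SimpleMap.exists_map_eq hφ
  rcases hγ1.eq_or_lt with rfl | hγ1
  · have he : (f.map u).map ((1 : ℝ) * ·) = f.map u :=
      SimpleMap.ext_fun fun s => one_mul _
    rw [he, one_mul]
  have hmix : ∀ α : Weight, (mixAct hX α f (constAct h𝒜 w)).map u =
      (f.map u).map ((α : ℝ) * ·) := fun α => SimpleMap.ext_fun fun s => by
    rw [map_mixAct hu]
    simp [SimpleMap.const, hw, SimpleMap.map]
  have hmixc : ∀ (α : Weight) (y : X),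
      V ((mixAct hX α (constAct h𝒜 y) (constAct h𝒜 w)).map u) = α * u y := fun α y => by
    refine (hV.const (mixX hX α y w)).trans ?_
    rw [hu, hw, mul_zero, add_zero]
  let γ' : Weight := ⟨γ, hγ0.le, hγ1.le⟩
  obtain ⟨_, ⟨s₀, rfl⟩, hs₀⟩ :=
    Set.exists_max_image _ id (f.map u).finite_range (range_nonempty _)
  have hupper : V ((f.map u).map (γ * ·)) ≤ γ * u (f.toFun s₀) := by
    rw [← hmixc γ' (f.toFun s₀), ← hmix γ']
    refine hV.mono hX' h (fun s => ⟨_, rfl⟩) (fun s => ⟨_, rfl⟩) fun s => ?_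
    rw [map_mixAct hu, map_mixAct hu]
    have : u (f.toFun s) ≤ u (f.toFun s₀) := hs₀ _ ⟨s, rfl⟩
    simpa [SimpleMap.const, hw] using mul_le_mul_of_nonneg_left this hγ0.le
  -- `y` is the consequence whose `γ`-scaling is indifferent to that of `f`.
  obtain ⟨y, hy⟩ : V ((f.map u).map (γ * ·)) / γ ∈ range u :=
    hu.ordConnected_range.out h0.1 ⟨f.toFun s₀, rfl⟩
      ⟨div_nonneg (h0.2 (hV.mem_range _)) hγ0.le, (div_le_iff₀' hγ0).2 hupper⟩
  have hy' : V ((f.map u).map (γ * ·)) = γ * u y := by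
    rw [hy]
    field_simp
  have hstep : ∀ β : Weight, γ ≤ β → (β : ℝ) < 1 → β * u y ≤ V (f.map u) := fun β h1 h2 => by
    have h3 := hd f y γ' β hγ0 h1 h2 ((hV.rel_iff _ _).2 (by rw [hmixc, hmix]; exact hy'.ge))
    rw [hV.rel_iff, hmixc, hmix] at h3
    refine h3.trans ?_
    rw [← hmix]
    refine hV.mono hX' h (fun s => ⟨_, rfl⟩) (fun s => ⟨_, rfl⟩) fun s => ?_
    rw [map_mixAct hu]
    have hs : 0 ≤ u (f.toFun s) := h0.2 ⟨_, rfl⟩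
    simpa [SimpleMap.const, SimpleMap.map, hw] using mul_le_of_le_one_left hs β.2.2
  -- Let the weight `β` tend to `1`.
  rw [hy']
  refine mul_le_mul_of_nonneg_left ?_ hγ0.le
  by_contra! hlt
  have hu0 : 0 < u y := (h0.2 (hV.mem_range _)).trans_lt hlt
  obtain ⟨b, hb, hb1⟩ := exists_between (max_lt hγ1 ((div_lt_one hu0).2 hlt))
  have hbγ := (le_max_left _ _).trans hb.le
  have := hstep ⟨b, hγ0.le.trans hbγ, hb1.le⟩ hbγ hb1
  have h4 := (div_lt_iff₀ hu0).1 ((le_max_right _ _).trans_lt hb)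
  exact absurd this (not_le.2 h4)

end Represents

end Functional

/-! ### Aggregators supporting the functional -/

section Support

variable {S : Type*} {𝒜 : Set (Set S)} {h𝒜 : IsSetAlgebra 𝒜}

/-- The aggregator `G(t, p) = sup {c λ : λ ≥ 1, λ ∫ φ dp ≤ t}`. When `c ≥ 0` and `∫ φ dp > 0` this is
`c t / ∫ φ dp` for `t ≥ ∫ φ dp`, and it is `-∞` for `t < ∫ φ dp`. -/
noncomputable def rayAggregator (φ : SimpleMap h𝒜 ℝ) (c : ℝ) : Aggregator h𝒜 := fun t p =>
  ⨆ l : {l : ℝ // 1 ≤ l ∧ l * integral φ p ≤ t}, ((c * l : ℝ) : EReal)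

variable {φ ψ : SimpleMap h𝒜 ℝ} {c : ℝ}

theorem le_rayAggregator {t l : ℝ} {p : FinAddProb h𝒜} (h1 : 1 ≤ l) (h2 : l * integral φ p ≤ t) :
    ((c * l : ℝ) : EReal) ≤ rayAggregator φ c t p :=
  le_iSup (fun l : {l : ℝ // 1 ≤ l ∧ l * integral φ p ≤ t} => ((c * l : ℝ) : EReal)) ⟨l, h1, h2⟩

theorem rayAggregator_monotoneFst : (rayAggregator φ c).MonotoneFst := fun _ _ _ h =>
  iSup_le fun ⟨_, h1, h2⟩ => le_rayAggregator h1 (h2.trans h)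

theorem rayAggregator_posSuperhomFst : (rayAggregator φ c).PosSuperhomFst := by
  intro p t γ h0 h1
  refine iSup_le fun ⟨l, hl1, hl2⟩ => ?_
  have h : ((c * (l / γ) : ℝ) : EReal) ≤ rayAggregator φ c t p := by
    refine le_rayAggregator ((one_le_div h0).2 (h1.le.trans hl1)) ?_
    rw [div_mul_eq_mul_div, div_le_iff₀' h0]
    exact hl2
  have h' := mul_le_mul_of_nonneg_left h (show (0 : EReal) ≤ (γ : EReal) by exact_mod_cast h0.le)
  refine le_trans (le_of_eq ?_) h'
  rw [← EReal.coe_mul]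
  congr 1
  field_simp

theorem rayAggregator_quasiconvex : (rayAggregator φ c).Quasiconvex := by
  intro α t t' p p'
  refine iSup_le fun ⟨l, hl1, hl2⟩ => ?_
  rw [integral_mix] at hl2
  -- A ratio `l` that is feasible at the mixture is feasible at one of the two points.
  by_cases h : l * integral φ p ≤ t
  · exact le_max_of_le_left (le_rayAggregator hl1 h)
  · refine le_max_of_le_right ?_
    rcases α.2.2.eq_or_lt with hα | hα
    · rw [hα] at hl2
      exact absurd (by linarith) h
    · refine le_rayAggregator hl1 ?_
      by_contra! h'
      nlinarith [mul_le_mul_of_nonneg_left (not_le.1 h).le α.2.1,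
        mul_lt_mul_of_pos_left h' (sub_pos.2 hα)]

theorem le_infValue_rayAggregator : (c : EReal) ≤ (rayAggregator φ c).infValue φ :=
  le_iInf fun p => by
    have h := le_rayAggregator (φ := φ) (c := c) (p := p) le_rfl (one_mul (integral φ p)).le
    rwa [mul_one] at h

/-- The infimum over `p` is bounded through point masses alone: it is `-∞` unless `φ ≤ ψ`, and
otherwise at most `c` times the least ratio `ψ s / φ s`. -/
theorem infValue_rayAggregator_le (hc : 0 ≤ c) (hφ : ∀ s, 0 ≤ φ.toFun s) {v : ℝ}
    (hne : ∃ s, 0 < φ.toFun s)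
    (hv : ∀ l : ℝ, 1 ≤ l → (∀ s, l * φ.toFun s ≤ ψ.toFun s) → c * l ≤ v) :
    (rayAggregator φ c).infValue ψ ≤ (v : EReal) := by
  have hpoint : ∀ s, (rayAggregator φ c).infValue ψ ≤
      ⨆ l : {l : ℝ // 1 ≤ l ∧ l * φ.toFun s ≤ ψ.toFun s}, ((c * l : ℝ) : EReal) := fun s => by
    refine (iInf_le _ (FinAddProb.dirac h𝒜 s)).trans ?_
    rw [rayAggregator, integral_dirac, integral_dirac]
  by_cases hdom : ∀ s, φ.toFun s ≤ ψ.toFun s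
  · let χ := SimpleMap.map₂ Prod.mk φ ψ
    obtain ⟨s₁, hs₁⟩ := hne
    have hfin : (range χ.toFun ∩ {q | 0 < q.1}).Finite := χ.finite_range.inter_of_left _
    obtain ⟨_, ⟨⟨s₀, rfl⟩, hpos⟩, hmin⟩ := Set.exists_min_image _ (fun q : ℝ × ℝ => q.2 / q.1) hfin
      ⟨_, ⟨s₁, rfl⟩, hs₁⟩
    have hpos : 0 < φ.toFun s₀ := hpos
    refine (hpoint s₀).trans (iSup_le fun ⟨l, hl1, hl2⟩ => EReal.coe_le_coe_iff.2 ?_)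
    refine le_trans (mul_le_mul_of_nonneg_left ((le_div_iff₀ hpos).2 hl2) hc)
      (hv _ ((one_le_div hpos).2 (hdom s₀)) fun s => ?_)
    rcases (hφ s).eq_or_lt with h0 | h0
    · rw [← h0, mul_zero, h0]
      exact hdom s
    · have := hmin _ ⟨⟨s, rfl⟩, h0⟩
      exact (le_div_iff₀ h0).1 this
  · push Not at hdom
    obtain ⟨s, hs⟩ := hdom
    refine (hpoint s).trans (iSup_le fun ⟨l, hl1, hl2⟩ => absurd hs (not_lt.2 ?_))
    exact (le_mul_of_one_le_left (hφ s) hl1).trans hl2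

variable {K : Set ℝ} {V : SimpleMap h𝒜 ℝ → ℝ}

theorem infValue_rayAggregator_le_of_superhom [Nonempty S] (hK : K.OrdConnected)
    (h0 : IsLeast K 0)
    (hV0 : ∀ φ, (∀ s, φ.toFun s = 0) → V φ = 0) (hVnn : ∀ φ, 0 ≤ V φ)
    (hmono : ∀ φ ∈ B₀ h𝒜 K, ∀ ψ ∈ B₀ h𝒜 K, (∀ s, φ.toFun s ≤ ψ.toFun s) → V φ ≤ V ψ)
    (hsuper : ∀ φ ∈ B₀ h𝒜 K, ∀ γ : ℝ, 0 < γ → γ ≤ 1 → V (φ.map (γ * ·)) ≤ γ * V φ)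
    (hφ : φ ∈ B₀ h𝒜 K) (hψ : ψ ∈ B₀ h𝒜 K) :
    (rayAggregator φ (V φ)).infValue ψ ≤ (V ψ : EReal) := by
  have hφ0 : ∀ s, 0 ≤ φ.toFun s := fun s => h0.2 (hφ s)
  by_cases hne : ∃ s, 0 < φ.toFun s
  · refine infValue_rayAggregator_le (hVnn φ) hφ0 hne fun l hl hle => ?_
    have hl0 : 0 < l := one_pos.trans_le hl
    have hmem : φ.map (l * ·) ∈ B₀ h𝒜 K := fun s =>
      hK.out h0.1 (hψ s) ⟨mul_nonneg hl0.le (hφ0 s), hle s⟩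
    have h1 := hsuper _ hmem l⁻¹ (inv_pos.2 hl0) (inv_le_one_of_one_le₀ hl)
    have he : (φ.map (l * ·)).map (l⁻¹ * ·) = φ :=
      SimpleMap.ext_fun fun s => inv_mul_cancel_left₀ hl0.ne' _
    rw [he] at h1
    calc V φ * l ≤ l⁻¹ * V (φ.map (l * ·)) * l := mul_le_mul_of_nonneg_right h1 hl0.le
      _ = V (φ.map (l * ·)) := by field_simp
      _ ≤ V ψ := hmono _ hmem _ hψ hle
  · push Not at hne
    have hc : V φ = 0 := hV0 φ fun s => le_antisymm (hne s) (hφ0 s)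
    obtain ⟨s⟩ := ‹Nonempty S›
    refine (iInf_le _ (FinAddProb.dirac h𝒜 s)).trans (iSup_le fun ⟨l, _⟩ => ?_)
    rw [hc, zero_mul]
    exact EReal.coe_le_coe_iff.2 (hVnn ψ)

/-- The family of the aggregators `rayAggregator φ (V φ)` with `φ ∈ B₀(𝒜, K)`. -/
def raySupport (K : Set ℝ) (V : SimpleMap h𝒜 ℝ → ℝ) : Set (Aggregator h𝒜) :=
  (fun φ => rayAggregator φ (V φ)) '' B₀ h𝒜 K

theorem isGreatest_infValue_raySupport
    (hle : ∀ φ ∈ B₀ h𝒜 K, ∀ ψ ∈ B₀ h𝒜 K, (rayAggregator φ (V φ)).infValue ψ ≤ (V ψ : EReal))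
    (hψ : ψ ∈ B₀ h𝒜 K) :
    IsGreatest ((fun G => Aggregator.infValue G ψ) '' raySupport K V) (V ψ : EReal) := by
  refine ⟨⟨_, ⟨ψ, hψ, rfl⟩, le_antisymm (hle ψ hψ ψ hψ) le_infValue_rayAggregator⟩, ?_⟩
  rintro _ ⟨_, ⟨φ, hφ, rfl⟩, rfl⟩
  exact hle φ hφ ψ hψ

theorem maxInf_raySupport
    (hle : ∀ φ ∈ B₀ h𝒜 K, ∀ ψ ∈ B₀ h𝒜 K, (rayAggregator φ (V φ)).infValue ψ ≤ (V ψ : EReal))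
    (hψ : ψ ∈ B₀ h𝒜 K) : maxInf (raySupport K V) ψ = (V ψ : EReal) := by
  rw [maxInf, ← sSup_image]
  exact (isGreatest_infValue_raySupport hle hψ).csSup_eq

end Support

end AmbiguityModel

open AmbiguityModel in
theorem theorem2 {S : Type*} [Nonempty S] {𝒜 : Set (Set S)}
    (h𝒜 : MeasureTheory.IsSetAlgebra 𝒜)
    {E : Type*} [AddCommGroup E] [Module ℝ E] {X : Set E} (hX : Convex ℝ X) (hne : X.Nonempty)
    (R : AmbiguityModel.Act h𝒜 X → AmbiguityModel.Act h𝒜 X → Prop) :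
    (AmbiguityModel.IsMBA hX R ∧
      ∃ w : X, AmbiguityModel.IsWorst R w ∧
        AmbiguityModel.DecreasingRelativeAmbiguityAversion hX R w) ↔
    ∃ u : X → ℝ, AmbiguityModel.IsAffine hX u ∧ IsLeast (Set.range u) 0 ∧
      ∃ 𝒢 : Set (AmbiguityModel.Aggregator h𝒜),
        AmbiguityModel.LinearlyContinuous 𝒢 (Set.range u) ∧
        (∀ G ∈ 𝒢, G.MonotoneFst ∧ G.PosSuperhomFst ∧ G.Quasiconvex) ∧
        (∀ f g : AmbiguityModel.Act h𝒜 X,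
          R f g ↔ AmbiguityModel.maxInf 𝒢 (g.map u) ≤ AmbiguityModel.maxInf 𝒢 (f.map u)) ∧
        ∀ x : X, AmbiguityModel.maxInf 𝒢 ((AmbiguityModel.constAct h𝒜 x).map u)
          = ((u x : ℝ) : EReal) := by
  constructor
  · rintro ⟨h, w, hworst, hd⟩
    obtain ⟨u, hu, hw, hnn, hrel⟩ := h.exists_affine_utility hworst
    have h0 : IsLeast (range u) 0 := ⟨⟨w, hw⟩, by rintro _ ⟨x, rfl⟩; exact hnn x⟩
    obtain ⟨V, hV⟩ := h.exists_represents hne hrel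
    have hle : ∀ φ ∈ B₀ h𝒜 (range u), ∀ ψ ∈ B₀ h𝒜 (range u),
        (rayAggregator φ (V φ)).infValue ψ ≤ (V ψ : EReal) := fun φ hφ ψ hψ => by
      refine infValue_rayAggregator_le_of_superhom hu.ordConnected_range h0 (fun φ hφ => ?_)
        (fun φ => h0.2 (hV.mem_range φ)) (fun φ hφ ψ hψ => hV.mono hne h hφ hψ)
        (fun φ hφ γ => hV.mul_le hne h hu h0 hw hd hφ) hφ hψ
      rw [← hw, ← hV.const w]
      exact congrArg V (SimpleMap.ext_fun fun s => (hφ s).trans hw.symm)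
    have hmap : ∀ f : Act h𝒜 X, f.map u ∈ B₀ h𝒜 (range u) := fun f s => ⟨_, rfl⟩
    refine ⟨u, hu, h0, raySupport (range u) V, ⟨fun φ hφ => ?_, fun φ hφ W hW => ?_⟩, ?_,
      fun f g => ?_, fun x => ?_⟩
    · rw [MaxAttained, maxInf_raySupport hle hφ]
      exact isGreatest_infValue_raySupport hle hφ
    · rw [maxInf_raySupport hle hφ] at hW
      obtain ⟨a, b, ⟨ha, hb⟩, hab⟩ := mem_nhds_iff_exists_Ioo_subset.1
        (continuous_coe_real_ereal.continuousAt.preimage_mem_nhds hW)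
      obtain ⟨δ, hδ, hlow⟩ := hV.exists_lt_of_near hne h hu h0 hφ ha
      obtain ⟨δ', hδ', hup⟩ := hV.exists_gt_of_near hne h hu hφ hb
      refine ⟨min δ δ', lt_min hδ hδ', fun ψ hψ hnear => ?_⟩
      rw [maxInf_raySupport hle hψ]
      exact hab ⟨hlow ψ hψ fun s => (hnear s).trans_le (min_le_left _ _),
        hup ψ hψ fun s => (hnear s).trans_le (min_le_right _ _)⟩
    · rintro _ ⟨φ, -, rfl⟩
      exact ⟨rayAggregator_monotoneFst, rayAggregator_posSuperhomFst, rayAggregator_quasiconvex⟩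
    · rw [maxInf_raySupport hle (hmap f), maxInf_raySupport hle (hmap g), EReal.coe_le_coe_iff]
      exact hV.rel_iff f g
    · rw [maxInf_raySupport hle (hmap _), hV.const]
  · rintro ⟨u, hu, h0, 𝒢, hc, hG, hrep, hnorm⟩
    obtain ⟨w, hw⟩ := h0.1
    refine ⟨isMBA_of_maxInf hu hc (fun G hG' => (hG G hG').1) hrep hnorm, w, fun y => ?_,
      decreasingRelativeAmbiguityAversion_of_maxInf hu (fun G hG' => (hG G hG').2.1) hrep hnorm hw⟩
    rw [hrep, hnorm, hnorm, EReal.coe_le_coe_iff, hw]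
    exact h0.2 ⟨y, rfl⟩
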